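/- Let $T$ be a complete first-order theory (in a language of arbitrary cardinality) that is stable, i.e. there are no formula $\varphi(x,y)$ (with $x,y$ finite tuples of variables), model $M\models T$ and tuples $(a_i)_{i<\omega},(b_j)_{j<\omega}$ in $M$ such that $M\models\varphi(a_i,b_j)\iff i<j$. For a set $\Delta$ of formulas, a finite tuple $x$ of variables and a subset $A$ of a model of $T$, let $L_{x,\Delta}(A)$ be the set of formulas obtained from a formula in the Boolean algebra generated by $\Delta$ by substituting for its variables variables from $x$ or elements of $A$ (in any way), and let $S_\Delta(A)$ be the set of all maximal consistent subsets of $L_{x,\Delta}(A)$, for all finite tuples $x$. A local type over $A$ is an element of $S_\Delta(A)$ for some finite $\Delta$. A formula $\varphi(x,b)$ divides over a set $B$ if for some $k<\omega$ there is, in an elementary extension, a sequence $(c_i)_{i<\omega}$ of realizations of $\mathrm{tp}(b/B)$ such that $\{\varphi(x,c_i):i<\omega\}$ is $k$-inconsistent. A set $p(x)$ of formulas forks over $B$ if it implies a finite disjunction $\bigvee_{j}\varphi_j(x,b_j)$ of formulas, with parameters in an elementary extension, each of which divides over $B$. Let $\kappa_{\mathrm{loc}}(T)$ be the smallest cardinal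 $\kappa$ such that for every subset $A$ of a model of $T$, every local type over $A$ does not fork over some $A_0\subseteq A$ with $|A_0|<\kappa$ (and $\kappa_{\mathrm{loc}}(T)=\infty$ if there is no such $\kappa$). Then every local type $p\in S_\Delta(A)$ over a subset $A$ of a model of $T$ does not fork over some finite subset $A_0\subseteq A$. If moreover $T$ has an infinite model, then $\kappa_{\mathrm{loc}}(T)=\aleph_0$. -/

import Mathlib

open FirstOrder Cardinal

universe u v w

namespace LocalForking

variable {L : FirstOrder.Language.{u, v}}

/-- The Boolean algebra of formulas generated by a set `Δ` of formulas (whose variables are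
indexed by `ℕ`). -/
inductive BoolGenerated (Δ : Set (L.Formula ℕ)) : L.Formula ℕ → Prop
  | of_mem {φ : L.Formula ℕ} : φ ∈ Δ → BoolGenerated Δ φ
  | bot : BoolGenerated Δ ⊥
  | not {φ : L.Formula ℕ} : BoolGenerated Δ φ → BoolGenerated Δ φ.not
  | inf {φ ψ : L.Formula ℕ} : BoolGenerated Δ φ → BoolGenerated Δ ψ → BoolGenerated Δ (φ ⊓ ψ)
  | sup {φ ψ : L.Formula ℕ} : BoolGenerated Δ φ → BoolGenerated Δ ψ → BoolGenerated Δ (φ ⊔ ψ)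

/-- `L_{x,Δ}(A)` for `x = (x_0, …, x_{n-1})`: the formulas obtained from a formula in the Boolean
algebra generated by `Δ` by substituting, for each of its variables, one of the variables `x_i` or
an element of `A`.  A formula over `A` in the variables `x` is represented as an `L`-formula with
variables in `A ⊕ Fin n`, where the variables from `A` are always evaluated at themselves. -/
def localFormulas (Δ : Set (L.Formula ℕ)) {M : Type*} (A : Set M) (n : ℕ) :
    Set (L.Formula (A ⊕ Fin n)) :=
  {ψ | ∃ φ : L.Formula ℕ, BoolGenerated Δ φ ∧ ∃ σ : ℕ → A ⊕ Fin n, ψ = φ.relabel σ}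

section Types

variable {M : Type*} [L.Structure M] {N : Type*} [L.Structure N] {n : ℕ}

/-- The tuple `x` in an elementary extension `f : M ↪ₑ[L] N` realizes the set `p` of formulas over
`A ⊆ M`. -/
def Realizes (f : M ↪ₑ[L] N) {A : Set M} (p : Set (L.Formula (A ⊕ Fin n))) (x : Fin n → N) :
    Prop :=
  ∀ φ ∈ p, φ.Realize (Sum.elim (fun a : A => f (a : M)) x)

/-- The tuple `c` in an elementary extension `f : M ↪ₑ[L] N` has the same complete type over
`A ⊆ M` as the tuple `b` in `M`. -/
def SameType (f : M ↪ₑ[L] N) (A : Set M) {m : ℕ} (b : Fin m → M) (c : Fin m → N) : Prop :=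
  ∀ ψ : L.Formula (A ⊕ Fin m),
    ψ.Realize (Sum.elim (fun a : A => f (a : M)) c) ↔ ψ.Realize (Sum.elim (fun a : A => (a : M)) b)

end Types

/-- No formula `φ(x, y)` (with `x`, `y` finite tuples) has the order property in `T`. -/
def IsStable (T : L.Theory) : Prop :=
  ∀ (m n : ℕ) (φ : L.Formula (Fin m ⊕ Fin n)) (M : Type (max u v w)) [L.Structure M] [M ⊨ T],
    ¬ ∃ (a : ℕ → Fin m → M) (b : ℕ → Fin n → M),
      ∀ i j : ℕ, φ.Realize (Sum.elim (a i) (b j)) ↔ i < j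

section Forking

variable {M : Type (max u v w)} [L.Structure M] {n : ℕ}

/-- A set of formulas over `A ⊆ M` is consistent (with the elementary diagram of `M`): it is
realized in some elementary extension of `M`. -/
def IsConsistentOver {A : Set M} (p : Set (L.Formula (A ⊕ Fin n))) : Prop :=
  ∃ (N : Type (max u v w)) (_ : L.Structure N) (f : M ↪ₑ[L] N) (x : Fin n → N), Realizes f p x

/-- `S_Δ(A)` in the variables `x_0, …, x_{n-1}`: the maximal consistent subsets of
`L_{x,Δ}(A)`. -/
def deltaTypes (Δ : Set (L.Formula ℕ)) (A : Set M) (n : ℕ) : Set (Set (L.Formula (A ⊕ Fin n))) :=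
  {p | Maximal (fun q => q ⊆ localFormulas Δ A n ∧ IsConsistentOver.{u, v, w} q) p}

/-- The formula `φ(x, b)` divides over `A`: for some `k`, there is a sequence `(c_i)` of
realizations of `tp(b / A)`, in an elementary extension, such that `{φ(x, c_i) : i < ω}` is
`k`-inconsistent.  The tuple `y` is the left summand of the variables of `φ`. -/
def Divides (A : Set M) {m : ℕ} (φ : L.Formula (Fin m ⊕ Fin n)) (b : Fin m → M) : Prop :=
  ∃ (k : ℕ) (N : Type (max u v w)) (_ : L.Structure N) (f : M ↪ₑ[L] N) (c : ℕ → Fin m → N),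
    (∀ i, SameType f A b (c i)) ∧
    ∀ s : Finset ℕ, s.card = k → ¬ ∃ x : Fin n → N, ∀ i ∈ s, φ.Realize (Sum.elim (c i) x)

/-- The set `p` of formulas over `A ⊆ M` forks over `A₀`: it implies a finite disjunction of
formulas `φ_j(x, b_j)`, with parameters in an elementary extension, each of which divides over
`A₀`. -/
def Forks {A : Set M} (p : Set (L.Formula (A ⊕ Fin n))) (A₀ : Set M) : Prop :=
  ∃ (N : Type (max u v w)) (_ : L.Structure N) (f : M ↪ₑ[L] N) (d : ℕ) (m : Fin d → ℕ)
    (φ : ∀ j, L.Formula (Fin (m j) ⊕ Fin n)) (b : ∀ j, Fin (m j) → N),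
    (∀ j, Divides.{u, v, w} (f '' A₀) (φ j) (b j)) ∧
    ∀ (N' : Type (max u v w)) [L.Structure N'] (g : N ↪ₑ[L] N') (x : Fin n → N'),
      Realizes (g.comp f) p x → ∃ j, (φ j).Realize (Sum.elim (fun i => g (b j i)) x)

end Forking

/-- Every local type `p ∈ S_Δ(A)` (with `Δ` finite, in finitely many variables, over a subset `A`
of a model of `T`) does not fork over some subset of `A` of size `< κ`. -/
def LocalCharacter (T : L.Theory) (κ : Cardinal.{max u v w}) : Prop :=
  ∀ (M : Type (max u v w)) [L.Structure M] [M ⊨ T] [Nonempty M] (A : Set M)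
    (Δ : Set (L.Formula ℕ)) (n : ℕ), Δ.Finite → ∀ p ∈ deltaTypes.{u, v, w} Δ A n,
      ∃ A₀ : Set M, A₀ ⊆ A ∧ #A₀ < κ ∧ ¬ Forks.{u, v, w} p A₀

/-- `κ_loc(T)`: the least `κ` with `LocalCharacter T κ`, and `∞ = ⊤` if there is none. -/
noncomputable def kappaLoc (T : L.Theory) : WithTop Cardinal.{max u v w} :=
  sInf ((fun κ : Cardinal.{max u v w} => (κ : WithTop Cardinal.{max u v w})) ''
    {κ | LocalCharacter.{u, v, w} T κ})

end LocalForking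

/-! The proof uses local ranks of Cantor–Bendixson type. Fix a finite family of formulas. A
definable set has rank at least `k + 1` if instances of the family cut arbitrarily many disjoint
pieces of rank at least `k` off it, one after another. Each finite approximation of "rank at least
`k`" is first-order and uniform in the parameters, so ranks are invariant under elementary
embeddings and depend only on the types of the parameters. Sets of small rank form an ideal.
Stability bounds the ranks: high rank yields high binary trees, trees yield long half graphs
(`exists_halfGraph_of_tree`), and an ultrapower turns these into the order property
(`IsStable.exists_not_level`).

For a local type `p` realized by `x`, consider the formulas over `A` true of `x` and the largest `r`
such that all of them have rank at least `r`. One of them, `θ`, cannot be cut by an instance over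
`A` so that the side not containing `x` still has rank `r` (`exists_isolating`). Hence every formula
of `p` holds on `θ` up to rank less than `r`, and `p` does not fork over the finitely many
parameters of `θ` (`not_forks_of_isolating`). Indeed, suppose `p` implies a disjunction of dividing
formulas `φ j`. Build a second rank for the family `φ`, whose bottom level is "`θ ∩ S` has rank at
least `r`". Some disjunct has the same second rank as the whole space. Its conjugates over the
parameters of `θ` also have that rank and are `k`-inconsistent, which forces the rank of the whole
space up by one (`large_of_inconsistent`), a contradiction.

For the lower bound on `κ_loc`, counting types gives `k` elements, each with infinitely many
conjugates over the others. The equality type of a tuple enumerating them, over the set of these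
elements, forks over every subset with fewer than `k` elements. -/

namespace LocalForking

/-! ### Splitting ranks for an abstract family of sets. -/

section Combinatorics

variable {X I : Type*}

/-- There is a sequence of `t` successive splittings of `S` by sets of the family `R`, each
splitting off a piece satisfying `P` and continuing with the other piece. -/
def Comb (R : I → Set X) (P : Set X → Prop) : ℕ → Set X → Prop
  | 0, _ => True
  | t + 1, S => ∃ i, (P (S \ R i) ∧ Comb R P t (S ∩ R i)) ∨ (P (S ∩ R i) ∧ Comb R P t (S \ R i))

/-- The iterated comb predicate: `Level R P k` says that a set has local rank at least `k` over `P`,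
up to an approximation which is better for larger `N`. -/
def Level (R : I → Set X) (P : ℕ → Set X → Prop) : ℕ → ℕ → Set X → Prop
  | 0 => P
  | k + 1 => fun N => Comb R (Level R P k N) N

/-- A notion of largeness of sets given by a decreasing sequence of approximations. -/
structure Graded (P : ℕ → Set X → Prop) : Prop where
  mono : ∀ {N : ℕ} {S S' : Set X}, S ⊆ S' → P N S → P N S'
  anti : ∀ {N N' : ℕ} {S : Set X}, N ≤ N' → P N' S → P N S
  union : ∀ {N : ℕ} {S S' : Set X}, P (2 * N) (S ∪ S') → P N S ∨ P N S'

/-- A set is large if it satisfies all the approximations. -/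
def Large (P : ℕ → Set X → Prop) (S : Set X) : Prop := ∀ N, P N S

theorem Comb.mono {R : I → Set X} {P P' : Set X → Prop} (hP : ∀ S S', S ⊆ S' → P S → P' S') :
    ∀ {t : ℕ} {S S' : Set X}, S ⊆ S' → Comb R P t S → Comb R P' t S'
  | 0, _, _, _, _ => trivial
  | t + 1, S, S', h, ⟨i, hi⟩ => by
    have h1 : S \ R i ⊆ S' \ R i := Set.sdiff_subset_sdiff_left h
    have h2 : S ∩ R i ⊆ S' ∩ R i := Set.inter_subset_inter_left _ h
    refine ⟨i, hi.imp ?_ ?_⟩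
    · exact fun ⟨a, b⟩ => ⟨hP _ _ h1 a, Comb.mono hP h2 b⟩
    · exact fun ⟨a, b⟩ => ⟨hP _ _ h2 a, Comb.mono hP h1 b⟩

theorem Comb.of_succ {R : I → Set X} {P : Set X → Prop} (hP : ∀ S S', S ⊆ S' → P S → P S')
    {t : ℕ} {S : Set X} : Comb R P (t + 1) S → Comb R P t S := by
  rintro ⟨i, ⟨-, h⟩ | ⟨-, h⟩⟩
  · exact Comb.mono hP Set.inter_subset_left h
  · exact Comb.mono hP Set.sdiff_subset h

theorem Comb.of_le {R : I → Set X} {P : Set X → Prop} (hP : ∀ S S', S ⊆ S' → P S → P S')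
    {t t' : ℕ} (h : t ≤ t') {S : Set X} (hS : Comb R P t' S) : Comb R P t S := by
  induction h with
  | refl => exact hS
  | step _ ih => exact ih (Comb.of_succ hP hS)

/-- A pigeonhole count: each piece split off the union is large in `S` or in `S'`, so among `s + t`
pieces either `s` count for `S` or `t` for `S'`. This makes the sets that are not large an ideal. -/
theorem Comb.union {R : I → Set X} {P P' : Set X → Prop} (hP : ∀ S S', S ⊆ S' → P S → P S')
    (hP' : ∀ S S', P' (S ∪ S') → P S ∨ P S') :
    ∀ {d s t : ℕ} {S S' : Set X}, s + t = d → Comb R P' d (S ∪ S') →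
      Comb R P s S ∨ Comb R P t S'
  | 0, s, t, _, _, h, _ => by
    obtain rfl : s = 0 := by omega
    exact Or.inl trivial
  | d + 1, s, t, S, S', h, hd => by
    rcases s with _ | s
    · exact Or.inl trivial
    rcases t with _ | t
    · exact Or.inr trivial
    -- `U` is the piece split off and `V` the piece kept; the two orientations of a splitting are
    -- treated together.
    have key : ∀ U V : Set X → Set X, (∀ S S', U (S ∪ S') = U S ∪ U S') →
        (∀ S S', V (S ∪ S') = V S ∪ V S') → (∀ S, V S ⊆ S) →
        P' (U (S ∪ S')) → Comb R P' d (V (S ∪ S')) →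
        (P (U S) ∧ Comb R P s (V S)) ∨ (P (U S') ∧ Comb R P t (V S')) ∨
          Comb R P (s + 1) S ∨ Comb R P (t + 1) S' := by
      intro U V hU hV hVs h1 h2
      rw [hU] at h1
      rw [hV] at h2
      rcases hP' _ _ h1 with h1 | h1
      · rcases Comb.union hP hP' (s := s) (t := t + 1) (by omega) h2 with h2 | h2
        · exact Or.inl ⟨h1, h2⟩
        · exact Or.inr (Or.inr (Or.inr (Comb.mono hP (hVs _) h2)))
      · rcases Comb.union hP hP' (s := s + 1) (t := t) (by omega) h2 with h2 | h2
        · exact Or.inr (Or.inr (Or.inl (Comb.mono hP (hVs _) h2)))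
        · exact Or.inr (Or.inl ⟨h1, h2⟩)
    obtain ⟨i, ⟨h1, h2⟩ | ⟨h1, h2⟩⟩ := hd
    · rcases key (· \ R i) (· ∩ R i) (fun _ _ => Set.union_sdiff_distrib)
        (fun _ _ => Set.union_inter_distrib_right _ _ _) (fun _ => Set.inter_subset_left) h1 h2 with
        h | h | h
      · exact Or.inl ⟨i, Or.inl h⟩
      · exact Or.inr ⟨i, Or.inl h⟩
      · exact h
    · rcases key (· ∩ R i) (· \ R i) (fun _ _ => Set.union_inter_distrib_right _ _ _)
        (fun _ _ => Set.union_sdiff_distrib) (fun _ => Set.sdiff_subset) h1 h2 with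
        h | h | h
      · exact Or.inl ⟨i, Or.inr h⟩
      · exact Or.inr ⟨i, Or.inr h⟩
      · exact h

theorem Graded.level {R : I → Set X} {P : ℕ → Set X → Prop} (hP : Graded P) (k : ℕ) :
    Graded (Level R P k) := by
  induction k with
  | zero => exact hP
  | succ k ih =>
    refine ⟨?_, ?_, ?_⟩
    · exact fun h => Comb.mono (fun _ _ h => ih.mono h) h
    · intro N N' S h hS
      exact Comb.mono (fun _ _ h' h'' => ih.mono h' (ih.anti h h'')) subset_rfl
        (Comb.of_le (fun _ _ h => ih.mono h) h hS)
    · intro N S S' h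
      exact Comb.union (fun _ _ h => ih.mono h) (fun _ _ => ih.union) (by omega) h

/-- Positivity of `N` matters: a comb of length `0` exists on every set, even the empty one. -/
theorem Graded.level_le {R : I → Set X} {P : ℕ → Set X → Prop} (hP : Graded P) {k N : ℕ}
    (hN : 0 < N) {S : Set X} (h : Level R P k N S) : P N S := by
  induction k generalizing S with
  | zero => exact h
  | succ k ih =>
    obtain ⟨N, rfl⟩ : ∃ n, N = n + 1 := ⟨N - 1, by omega⟩
    obtain ⟨i, ⟨h, -⟩ | ⟨h, -⟩⟩ := h
    · exact hP.mono Set.sdiff_subset (ih h)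
    · exact hP.mono Set.inter_subset_left (ih h)

theorem Graded.large_of_level {R : I → Set X} {P : ℕ → Set X → Prop} (hP : Graded P) {k : ℕ}
    {S : Set X} (h : Large (Level R P k) S) : Large P S := fun N =>
  hP.anti N.le_succ (hP.level_le N.succ_pos (h (N + 1)))

theorem Large.mono {P : ℕ → Set X → Prop} (hP : Graded P) {S S' : Set X} (h : S ⊆ S')
    (hS : Large P S) : Large P S' := fun N => hP.mono h (hS N)

theorem Large.union {P : ℕ → Set X → Prop} (hP : Graded P) {S S' : Set X}
    (h : Large P (S ∪ S')) : Large P S ∨ Large P S' := by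
  by_contra hc
  simp only [Large, not_or, not_forall] at hc
  obtain ⟨⟨N, hN⟩, ⟨N', hN'⟩⟩ := hc
  rcases hP.union (h (2 * max N N')) with h | h
  · exact hN (hP.anti (le_max_left _ _) h)
  · exact hN' (hP.anti (le_max_right _ _) h)

theorem Large.exists_of_biUnion {P : ℕ → Set X → Prop} (hP : Graded P)
    (hne : ∀ S, Large P S → S.Nonempty) {ι : Type*} (F : Finset ι) (S : ι → Set X)
    (h : Large P (⋃ j ∈ F, S j)) : ∃ j ∈ F, Large P (S j) := by
  classical
  induction F using Finset.induction_on with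
  | empty => exact absurd (hne _ h) (by simp)
  | insert a F _ ih =>
    rw [Finset.set_biUnion_insert] at h
    rcases Large.union hP h with h | h
    · exact ⟨a, Finset.mem_insert_self _ _, h⟩
    · obtain ⟨j, hj, h⟩ := ih h
      exact ⟨j, Finset.mem_insert_of_mem hj, h⟩

theorem graded_nonempty : Graded (fun _ (S : Set X) => S.Nonempty) :=
  ⟨fun h h' => h'.mono h, fun _ h => h, fun h => Set.union_nonempty.1 h⟩

theorem Graded.inter {P : ℕ → Set X → Prop} (hP : Graded P) (U : Set X) :
    Graded (fun N S => P N (U ∩ S)) :=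
  ⟨fun h h' => hP.mono (Set.inter_subset_inter_right _ h) h', hP.anti,
    fun h => hP.union (by rwa [← Set.inter_union_distrib_left])⟩

/-- Infinitely many large sets of the family which are `k`-inconsistent make the ambient set
large at the next level. -/
theorem large_of_inconsistent {R : I → Set X} {P : ℕ → Set X → Prop} (hP : Graded P)
    (hne : ∀ S, Large P S → S.Nonempty) (i : ℕ → I) (k : ℕ) (T : Set ℕ) (hT : T.Infinite)
    (S : Set X) (hS : ∀ t ∈ T, Large P (S ∩ R (i t)))
    (hk : ∀ s : Finset ℕ, ↑s ⊆ T → s.card = k → ¬ ∃ x ∈ S, ∀ t ∈ s, x ∈ R (i t)) (N : ℕ) :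
    Comb R (P N) N S := by
  classical
  induction k generalizing T S with
  | zero =>
    obtain ⟨t, ht⟩ := hT.nonempty
    obtain ⟨x, hx⟩ := hne _ (hS t ht)
    exact absurd ⟨x, hx.1, by simp⟩ (hk ∅ (by simp) rfl)
  | succ k ih =>
    by_cases hu : ∃ u ∈ T, {t ∈ T | Large P (S ∩ R (i u) ∩ R (i t))}.Infinite
    -- Inside `S ∩ R (i u)` the remaining sets are inconsistent with one set fewer, so the induction
    -- on `k` applies there.
    · obtain ⟨u, huT, hu⟩ := hu
      refine Comb.mono (fun _ _ h => hP.mono h) (Set.inter_subset_left (t := R (i u))) <|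
        ih ({t ∈ T | Large P (S ∩ R (i u) ∩ R (i t))} \ {u}) (hu.sdiff (Set.finite_singleton u)) _
          (fun t ht => ht.1.2) ?_
      rintro s hs rfl ⟨x, hx, hxs⟩
      have hus : u ∉ s := fun h => (hs h).2 rfl
      refine hk (insert u s) ?_ (Finset.card_insert_of_notMem hus) ⟨x, hx.1, ?_⟩
      · intro t ht
        rcases Finset.mem_insert.1 (Finset.mem_coe.1 ht) with rfl | ht
        · exact huT
        · exact (hs ht).1.1
      · intro t ht
        rcases Finset.mem_insert.1 ht with rfl | ht
        · exact hx.2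
        · exact hxs t ht
    · push Not at hu
      -- Now each set meets only finitely many others in a large set. Some `t` avoids all these
      -- exceptions for the indices in `F`, so `R (i t)` stays large after removal of the earlier
      -- sets and can be split off next.
      have greedy : ∀ (l : ℕ) (F : Finset ℕ), ↑F ⊆ T →
          Comb R (P N) l (S \ ⋃ u ∈ F, R (i u)) := by
        intro l
        induction l with
        | zero => exact fun _ _ => trivial
        | succ l ihl =>
          intro F hF
          have hfin : (⋃ u ∈ F, {t ∈ T | Large P (S ∩ R (i u) ∩ R (i t))}).Finite :=
            F.finite_toSet.biUnion fun u hu' => hu u (hF hu')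
          obtain ⟨t, htT, ht⟩ := (hT.sdiff hfin).nonempty
          have hl : Large P (((S \ ⋃ u ∈ F, R (i u)) ∩ R (i t)) ∪
              ⋃ u ∈ F, (S ∩ R (i u) ∩ R (i t))) := by
            refine Large.mono hP ?_ (hS t htT)
            rintro x ⟨hx, hxt⟩
            by_cases hxu : x ∈ ⋃ u ∈ F, R (i u)
            · obtain ⟨u, hu1, hu2⟩ := Set.mem_iUnion₂.1 hxu
              exact Or.inr (Set.mem_iUnion₂.2 ⟨u, hu1, ⟨hx, hu2⟩, hxt⟩)
            · exact Or.inl ⟨⟨hx, hxu⟩, hxt⟩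
          refine ⟨i t, Or.inr ⟨?_, ?_⟩⟩
          · rcases Large.union hP hl with hl | hl
            · exact hl N
            · obtain ⟨u, hu1, hu2⟩ := Large.exists_of_biUnion hP hne _ _ hl
              exact (ht (Set.mem_iUnion₂.2 ⟨u, hu1, htT, hu2⟩)).elim
          · have := ihl (insert t F) (by
              intro a ha
              rcases Finset.mem_insert.1 (Finset.mem_coe.1 ha) with rfl | ha
              exacts [htT, hF ha])
            rwa [Finset.set_biUnion_insert, Set.union_comm, ← Set.sdiff_sdiff] at this
      simpa using greedy N ∅ (by simp)

/-- A family of large sets closed under splitting by certain sets contains a set which is not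
further split, at the appropriate level. -/
theorem exists_minimal {R : I → Set X} {P : ℕ → Set X → Prop} {k : ℕ}
    (hk : ∀ S, ¬ Large (Level R P k) S) {𝒮 : Set (Set X)} (h𝒮 : 𝒮.Nonempty)
    (hl : ∀ S ∈ 𝒮, Large P S) {I₀ : Set I} {r : I → Prop}
    (hr : ∀ S ∈ 𝒮, ∀ i ∈ I₀, r i → S ∩ R i ∈ 𝒮) (hr' : ∀ S ∈ 𝒮, ∀ i ∈ I₀, ¬ r i → S \ R i ∈ 𝒮) :
    ∃ d, ∃ S ∈ 𝒮, Large (Level R P d) S ∧ ∀ i ∈ I₀, (r i → ¬ Large (Level R P d) (S \ R i)) ∧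
      (¬ r i → ¬ Large (Level R P d) (S ∩ R i)) := by
  classical
  have hex : ∃ k, ∃ S ∈ 𝒮, ¬ Large (Level R P k) S := ⟨k, h𝒮.imp fun S hS => ⟨hS, hk S⟩⟩
  -- `d` is the last level at which all members of `𝒮` are large; some `S₁` in `𝒮` fails at level `d
  -- + 1`.
  obtain ⟨d, hd⟩ : ∃ d, Nat.find hex = d + 1 := by
    refine Nat.exists_eq_succ_of_ne_zero fun h0 => ?_
    obtain ⟨S, hS, h⟩ := Nat.find_spec hex
    rw [h0] at h
    exact h (hl S hS)
  have hlarge : ∀ S ∈ 𝒮, Large (Level R P d) S := by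
    have := Nat.find_min hex (m := d) (by omega)
    push Not at this
    exact this
  obtain ⟨S₁, hS₁, h₁⟩ := Nat.find_spec hex
  rw [hd] at h₁
  obtain ⟨N, hN⟩ := not_forall.1 h₁
  by_contra hc
  refine hN (?_ : Comb R (Level R P d N) N S₁)
  -- If the conclusion failed, every member of `𝒮` would lose a large piece while the rest stayed in
  -- `𝒮`. Iterating gives combs of every length on `S₁`.
  have : ∀ t, ∀ S ∈ 𝒮, Comb R (Level R P d N) t S := by
    intro t
    induction t with
    | zero => exact fun _ _ => trivial
    | succ t ih =>
      intro S hS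
      by_contra hcomb
      refine hc ⟨d, S, hS, hlarge S hS, fun i hi => ⟨fun hri h => hcomb ?_, fun hri h => hcomb ?_⟩⟩
      · exact ⟨i, Or.inl ⟨h N, ih _ (hr S hS i hi hri)⟩⟩
      · exact ⟨i, Or.inr ⟨h N, ih _ (hr' S hS i hi hri)⟩⟩
  exact this N S₁ hS₁

/-! ### Binary trees and half graphs. -/

/-- `S` is split by a full binary tree of height `h` of sets of the family with indices in `B`. -/
def Tree (R : I → Set X) : ℕ → Set I → Set X → Prop
  | 0, _, S => S.Nonempty
  | h + 1, B, S => ∃ i ∈ B, Tree R h B (S ∩ R i) ∧ Tree R h B (S \ R i)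

theorem Tree.mono {R : I → Set X} : ∀ {h : ℕ} {B : Set I} {S S' : Set X}, S ⊆ S' →
    Tree R h B S → Tree R h B S'
  | 0, _, _, _, h, hS => Set.Nonempty.mono h hS
  | _ + 1, _, _, _, h, ⟨i, hi, h1, h2⟩ =>
    ⟨i, hi, h1.mono (Set.inter_subset_inter_left _ h), h2.mono (Set.sdiff_subset_sdiff_left h)⟩

/-- Two teeth of a comb suffice for branching: the first piece lies on one side of `R i`, the second
inside the other side. -/
theorem Tree.of_level {R : I → Set X} {P : ℕ → Set X → Prop} (hP : ∀ S, P 2 S → S.Nonempty)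
    {k : ℕ} {S : Set X} (h : Level R P k 2 S) : Tree R k Set.univ S := by
  induction k generalizing S with
  | zero => exact hP S h
  | succ k ih =>
    obtain ⟨i, ⟨h1, j, ⟨h2, -⟩ | ⟨h2, -⟩⟩ | ⟨h1, j, ⟨h2, -⟩ | ⟨h2, -⟩⟩⟩ := h
    · exact ⟨i, trivial, (ih h2).mono Set.sdiff_subset, ih h1⟩
    · exact ⟨i, trivial, (ih h2).mono Set.inter_subset_left, ih h1⟩
    · exact ⟨i, trivial, ih h1, (ih h2).mono Set.sdiff_subset⟩
    · exact ⟨i, trivial, ih h1, (ih h2).mono Set.inter_subset_left⟩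

theorem Tree.nonempty {R : I → Set X} {h : ℕ} {B : Set I} {S : Set X} (hT : Tree R h B S) :
    S.Nonempty := by
  induction h generalizing S with
  | zero => exact hT
  | succ d ih =>
    obtain ⟨_, _, h, _⟩ := hT
    exact (ih h).mono Set.inter_subset_left

/-- Ramsey property of trees with nodes coloured by `B` and `C`: the colour of the root decides
which of the two heights to lower in both subtrees. -/
theorem Tree.union {R : I → Set X} {B C : Set I} : ∀ {d h k : ℕ} {S : Set X}, h + k = d →
    Tree R d (B ∪ C) S → Tree R h B S ∨ Tree R k C S
  | 0, h, k, S, e, hd => by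
    obtain rfl : h = 0 := by omega
    exact Or.inl hd
  | d + 1, h, k, S, e, ⟨i, hi, h1, h2⟩ => by
    have hS : S.Nonempty := h1.nonempty.mono Set.inter_subset_left
    rcases h with _ | h
    · exact Or.inl hS
    rcases k with _ | k
    · exact Or.inr hS
    rcases hi with hi | hi
    · rcases Tree.union (h := h) (k := k + 1) (by omega) h1 with h1 | h1
      · rcases Tree.union (h := h) (k := k + 1) (by omega) h2 with h2 | h2
        · exact Or.inl ⟨i, hi, h1, h2⟩
        · exact Or.inr (h2.mono Set.sdiff_subset)
      · exact Or.inr (h1.mono Set.inter_subset_left)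
    · rcases Tree.union (h := h + 1) (k := k) (by omega) h1 with h1 | h1
      · exact Or.inl (h1.mono Set.inter_subset_left)
      · rcases Tree.union (h := h + 1) (k := k) (by omega) h2 with h2 | h2
        · exact Or.inl (h2.mono Set.sdiff_subset)
        · exact Or.inr ⟨i, hi, h1, h2⟩

theorem exists_not_tree_biUnion {R : I → Set X} {J : Type*} (F : Finset J) (B : J → Set I)
    (hB : ∀ j, ∃ h, ¬ Tree R h (B j) Set.univ) :
    ∃ h, ¬ Tree R h (⋃ j ∈ F, B j) Set.univ := by
  classical
  induction F using Finset.induction_on with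
  | empty => exact ⟨1, fun ⟨i, hi, _⟩ => by simp at hi⟩
  | insert a F _ ih =>
    obtain ⟨h, hh⟩ := ih
    obtain ⟨k, hk⟩ := hB a
    refine ⟨k + h, fun ht => ?_⟩
    rw [Finset.set_biUnion_insert] at ht
    exact (Tree.union rfl ht).elim hk hh

/-- A half graph of length `n` between points of `S` and indices in `B`. -/
def HalfGraph (R : I → Set X) : ℕ → Set I → Set X → Prop
  | 0, _, _ => True
  | n + 1, B, S => ∃ a ∈ S, ∃ b ∈ B, a ∈ R b ∧ HalfGraph R n {i ∈ B | a ∈ R i} (S \ R b)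

theorem HalfGraph.mono {R : I → Set X} : ∀ {n : ℕ} {B B' : Set I} {S S' : Set X}, B ⊆ B' →
    S ⊆ S' → HalfGraph R n B S → HalfGraph R n B' S'
  | 0, _, _, _, _, _, _, _ => trivial
  | _ + 1, _, _, _, _, hB, hS, ⟨a, ha, b, hb, h1, h2⟩ =>
    ⟨a, hS ha, b, hB hb, h1, h2.mono (fun _ h => ⟨hB h.1, h.2⟩) (Set.sdiff_subset_sdiff_left hS)⟩

theorem HalfGraph.exists_seq {R : I → Set X} : ∀ {n : ℕ} {B : Set I} {S : Set X},
    HalfGraph R n B S → ∃ (a : Fin n → X) (b : Fin n → I), (∀ s, a s ∈ S) ∧ (∀ t, b t ∈ B) ∧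
      ∀ s t, a s ∈ R (b t) ↔ s ≤ t
  | 0, _, _, _ => ⟨Fin.elim0, Fin.elim0, fun s => s.elim0, fun s => s.elim0, fun s => s.elim0⟩
  | n + 1, B, S, ⟨a, ha, b, hb, hab, h⟩ => by
    obtain ⟨a', b', ha', hb', h⟩ := h.exists_seq
    refine ⟨Fin.cons a a', Fin.cons b b', ?_, ?_, ?_⟩
    · exact Fin.cases ha fun s => (ha' s).1
    · exact Fin.cases hb fun s => (hb' s).1
    · refine Fin.cases (Fin.cases (by simpa using hab) fun t => ?_) fun s =>
        (Fin.cases ?_ fun t => ?_)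
      · simpa using (hb' t).2
      · simpa using (ha' s).2
      · simpa using h s t

/-- A family with high binary trees contains long half graphs. -/
theorem exists_halfGraph_of_tree (R : I → Set X) (p q : ℕ) : ∃ h, ∀ B S, Tree R h B S →
    HalfGraph R p B S ∨ HalfGraph (fun i => (R i)ᶜ) q B S := by
  induction p generalizing q with
  | zero => exact ⟨0, fun _ _ _ => Or.inl trivial⟩
  | succ p ihp =>
    induction q with
    | zero => exact ⟨0, fun _ _ _ => Or.inr trivial⟩
    | succ q ihq =>
      obtain ⟨h, hh⟩ := ihp (q + 1)
      obtain ⟨k, hk⟩ := ihq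
      refine ⟨(h + 1) + (k + 1), fun B S hT => ?_⟩
      obtain ⟨a, ha⟩ := hT.nonempty
      -- Colour each index by whether its set contains the fixed point `a`. In a monochromatic
      -- subtree, `a` and the root index `b` begin the half graph, and the branch on the side of `b`
      -- not containing `a` supplies the rest.
      have hB : B = {i ∈ B | a ∈ R i} ∪ {i ∈ B | a ∈ (R i)ᶜ} := by
        ext i
        by_cases hi : a ∈ R i <;> simp [hi]
      rw [hB] at hT
      rcases Tree.union rfl hT with ⟨b, hb, -, hT⟩ | ⟨b, hb, hT, -⟩
      · rcases hh _ _ hT with h' | h'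
        · exact Or.inl ⟨a, ha, b, hb.1, hb.2, h'⟩
        · exact Or.inr (h'.mono (Set.sep_subset _ _) Set.sdiff_subset)
      · rcases hk _ _ hT with h' | h'
        · exact Or.inl (h'.mono (Set.sep_subset _ _) Set.inter_subset_left)
        · refine Or.inr ⟨a, ha, b, hb.1, hb.2, ?_⟩
          simpa only [Set.sdiff_compl] using h'

end Combinatorics

universe a

open FirstOrder.Language

/-! ### First-order definability of the rank approximations. -/

section Definability

variable {L : FirstOrder.Language.{u, v}} {n : ℕ}

/-- The family of all instances in `M` of the formulas `Φ j`. -/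
def instances {J : Type*} {m : J → ℕ} (Φ : ∀ j, L.Formula (Fin (m j) ⊕ Fin n)) (M : Type*)
    [L.Structure M] (i : Σ j, Fin (m j) → M) : Set (Fin n → M) :=
  {x | (Φ i.1).Realize (Sum.elim i.2 x)}

/-- The set defined by `χ` with parameters `v`. -/
def solutions {M : Type*} [L.Structure M] {α : Type*} (χ : L.Formula (α ⊕ Fin n)) (v : α → M) :
    Set (Fin n → M) :=
  {x | χ.Realize (Sum.elim v x)}

/-- A property of sets of `n`-tuples, depending on parameters `e`, is uniformly definable if it can
be expressed by a formula for every definable family of sets. -/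
def UniformlyDefinable {β : Type}
    (p : ∀ (M : Type (max u v w)) [L.Structure M], (β → M) → Set (Fin n → M) → Prop) : Prop :=
  ∀ (α : Type a) (g : β → α) (χ : L.Formula (α ⊕ Fin n)), ∃ ψ : L.Formula α,
    ∀ (M : Type (max u v w)) [L.Structure M] (e : α → M),
      p M (e ∘ g) (solutions χ e) ↔ ψ.Realize e

theorem solutions_inf {M : Type*} [L.Structure M] {α : Type*} (χ χ' : L.Formula (α ⊕ Fin n))
    (e : α → M) : solutions (χ ⊓ χ') e = solutions χ e ∩ solutions χ' e := by
  ext x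
  simp [solutions]

theorem solutions_not {M : Type*} [L.Structure M] {α : Type*} (χ : L.Formula (α ⊕ Fin n))
    (e : α → M) : solutions χ.not e = (solutions χ e)ᶜ := by
  ext x
  simp [solutions]

theorem solutions_relabel {M : Type*} [L.Structure M] {α β : Type*} (χ : L.Formula (α ⊕ Fin n))
    (g : α → β) (e : β → M) : solutions (χ.relabel (Sum.map g id)) e = solutions χ (e ∘ g) := by
  ext x
  simp only [solutions, Set.mem_ofPred_eq, Formula.realize_relabel, Sum.elim_comp_map,
    Function.comp_id]

theorem instances_eq_solutions {J : Type*} {m : J → ℕ} (Φ : ∀ j, L.Formula (Fin (m j) ⊕ Fin n))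
    (M : Type*) [L.Structure M] (j : J) (c : Fin (m j) → M) :
    instances Φ M ⟨j, c⟩ = solutions (Φ j) c := rfl

/-- One splitting is a quantifier over the parameters of the instance together with a disjunction
over `J`, which is a formula because `J` is finite. -/
theorem UniformlyDefinable.comb {β : Type}
    {p : ∀ (M : Type (max u v w)) [L.Structure M], (β → M) → Set (Fin n → M) → Prop}
    (hp : UniformlyDefinable.{u, v, w, a} p) {J : Type*} [Finite J] {m : J → ℕ}
    (Φ : ∀ j, L.Formula (Fin (m j) ⊕ Fin n)) (t : ℕ) :
    UniformlyDefinable.{u, v, w, a} (fun M (_ : L.Structure M) e => Comb (instances Φ M) (p M e) t) := by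
  induction t with
  | zero => exact fun α g χ => ⟨⊤, fun M _ e => by simp [Comb]⟩
  | succ t ih =>
    intro α g χ
    have key : ∀ j, ∃ ψ : L.Formula (α ⊕ Fin (m j)), ∀ (M : Type (max u v w)) [L.Structure M]
        (e : α → M) (c : Fin (m j) → M), ψ.Realize (Sum.elim e c) ↔
          ((p M (e ∘ g) (solutions χ e \ instances Φ M ⟨j, c⟩) ∧
            Comb (instances Φ M) (p M (e ∘ g)) t (solutions χ e ∩ instances Φ M ⟨j, c⟩)) ∨
          (p M (e ∘ g) (solutions χ e ∩ instances Φ M ⟨j, c⟩) ∧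
            Comb (instances Φ M) (p M (e ∘ g)) t (solutions χ e \ instances Φ M ⟨j, c⟩))) := by
      intro j
      let χ₀ : L.Formula ((α ⊕ Fin (m j)) ⊕ Fin n) := χ.relabel (Sum.map Sum.inl id)
      let χ₁ : L.Formula ((α ⊕ Fin (m j)) ⊕ Fin n) := (Φ j).relabel (Sum.map Sum.inr id)
      obtain ⟨ψ₁, h₁⟩ := hp _ (Sum.inl ∘ g) (χ₀ ⊓ χ₁.not)
      obtain ⟨ψ₂, h₂⟩ := ih _ (Sum.inl ∘ g) (χ₀ ⊓ χ₁)
      obtain ⟨ψ₃, h₃⟩ := hp _ (Sum.inl ∘ g) (χ₀ ⊓ χ₁)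
      obtain ⟨ψ₄, h₄⟩ := ih _ (Sum.inl ∘ g) (χ₀ ⊓ χ₁.not)
      refine ⟨(ψ₁ ⊓ ψ₂) ⊔ (ψ₃ ⊓ ψ₄), fun M _ e c => ?_⟩
      have e₀ : (Sum.elim e c ∘ Sum.inl ∘ g) = e ∘ g := rfl
      simp only [Formula.realize_sup, Formula.realize_inf, ← h₁, ← h₂, ← h₃, ← h₄, solutions_inf,
        solutions_not, χ₀, χ₁, solutions_relabel, Sum.elim_comp_inl, Sum.elim_comp_inr, e₀,
        ← instances_eq_solutions Φ M j c, Set.sdiff_eq]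
    choose ψ hψ using key
    refine ⟨Formula.iSup fun j => (ψ j).iExs (Fin (m j)), fun M _ e => ?_⟩
    simp only [Formula.realize_iSup, Formula.realize_iExs, hψ]
    constructor
    · rintro ⟨⟨j, c⟩, h⟩
      exact ⟨j, c, h⟩
    · rintro ⟨j, c, h⟩
      exact ⟨⟨j, c⟩, h⟩

theorem UniformlyDefinable.level {β : Type}
    {P : ∀ (M : Type (max u v w)) [L.Structure M], (β → M) → ℕ → Set (Fin n → M) → Prop}
    (hP : ∀ N, UniformlyDefinable.{u, v, w, a} (fun M (_ : L.Structure M) e => P M e N))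
    {J : Type*} [Finite J]
    {m : J → ℕ} (Φ : ∀ j, L.Formula (Fin (m j) ⊕ Fin n)) (k N : ℕ) :
    UniformlyDefinable.{u, v, w, a} (fun M (_ : L.Structure M) e => Level (instances Φ M) (P M e) k N) := by
  induction k with
  | zero => exact hP N
  | succ k ih => exact ih.comb Φ N

theorem uniformlyDefinable_nonempty {β : Type} :
    UniformlyDefinable.{u, v, w, a} (L := L) (n := n) (β := β) (fun M (_ : L.Structure M) _ S => S.Nonempty) := by
  refine fun α _ χ => ⟨χ.iExs (Fin n), fun M _ e => ?_⟩
  exact Formula.realize_iExs.symm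

theorem UniformlyDefinable.inter {β : Type}
    {p : ∀ (M : Type (max u v w)) [L.Structure M], (β → M) → Set (Fin n → M) → Prop}
    (hp : UniformlyDefinable.{u, v, w, a} p) (θ : L.Formula (β ⊕ Fin n)) :
    UniformlyDefinable.{u, v, w, a} (fun M (_ : L.Structure M) e S => p M e (solutions θ e ∩ S)) := by
  intro α g χ
  obtain ⟨ψ, hψ⟩ := hp α g (θ.relabel (Sum.map g id) ⊓ χ)
  refine ⟨ψ, fun M _ e => ?_⟩
  rw [← hψ, solutions_inf, solutions_relabel]

end Definability

/-! ### Compactness by ultrapowers. -/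

section Ultrapower

open Filter

variable {L : FirstOrder.Language.{u, v}}

/-- The diagonal embedding into an ultrapower. -/
noncomputable def diagonal {ι : Type*} (U : Ultrafilter ι) (M : Type*) [L.Structure M]
    [Nonempty M] : M ↪ₑ[L] (U : Filter ι).Product (fun _ => M) where
  toFun a := ((fun _ => a : ι → M) : (U : Filter ι).Product (fun _ => M))
  map_formula' _ φ x :=
    (Language.Ultraproduct.realize_formula_cast φ (fun i _ => x i)).trans eventually_const

theorem realize_ultrapower {ι : Type*} (U : Ultrafilter ι) {M : Type*} [L.Structure M]
    [Nonempty M] {α β : Type*} (φ : L.Formula (α ⊕ β)) (a : α → ι → M) (b : β → ι → M) :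
    φ.Realize (Sum.elim (fun i => (a i : (U : Filter ι).Product (fun _ => M)))
      (fun i => (b i : (U : Filter ι).Product (fun _ => M)))) ↔
      ∀ᶠ k in (U : Filter ι), φ.Realize (Sum.elim (fun i => a i k) (fun i => b i k)) := by
  have h := Language.Ultraproduct.realize_formula_cast (u := U) φ (Sum.elim a b)
  convert h using 2
  · ext i
    cases i <;> rfl
  · ext k
    apply iff_of_eq
    congr 1
    ext i
    cases i <;> rfl

theorem exists_infinite_sequences {M : Type w} [L.Structure M] [Nonempty M] {m n : ℕ}
    (φ : L.Formula (Fin m ⊕ Fin n)) (r : ℕ → ℕ → Prop)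
    (h : ∀ N : ℕ, ∃ (a : Fin N → Fin m → M) (b : Fin N → Fin n → M),
      ∀ s t, φ.Realize (Sum.elim (a s) (b t)) ↔ r s t) :
    ∃ (M' : Type w) (_ : L.Structure M') (_ : M ↪ₑ[L] M') (a : ℕ → Fin m → M')
      (b : ℕ → Fin n → M'), ∀ s t, φ.Realize (Sum.elim (a s) (b t)) ↔ r s t := by
  choose a b h using h
  let d : M := Classical.arbitrary M
  -- The default `d` is harmless: for fixed `s` it occurs only at finitely many coordinates, which
  -- the hyperfilter ignores.
  let a' : ℕ → Fin m → ℕ → M := fun s i N => if hs : s < N then a N ⟨s, hs⟩ i else d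
  let b' : ℕ → Fin n → ℕ → M := fun s i N => if hs : s < N then b N ⟨s, hs⟩ i else d
  let U : Ultrafilter ℕ := hyperfilter ℕ
  refine ⟨(U : Filter ℕ).Product (fun _ => M), inferInstance, diagonal U M,
    fun s i => (a' s i : (U : Filter ℕ).Product (fun _ => M)),
    fun s i => (b' s i : (U : Filter ℕ).Product (fun _ => M)), fun s t => ?_⟩
  refine (realize_ultrapower U φ (a' s) (b' t)).trans ?_
  have hev : ∀ᶠ N in (U : Filter ℕ),
      (φ.Realize (Sum.elim (fun i => a' s i N) (fun i => b' t i N)) ↔ r s t) := by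
    have h1 : ∀ᶠ N in (U : Filter ℕ), max s t < N := by
      refine Nat.hyperfilter_le_atTop (eventually_gt_atTop _)
    filter_upwards [h1] with N hN
    have hs : s < N := lt_of_le_of_lt (le_max_left _ _) hN
    have ht : t < N := lt_of_le_of_lt (le_max_right _ _) hN
    simp only [a', b', hs, ht, dif_pos]
    exact h N ⟨s, hs⟩ ⟨t, ht⟩
  rw [eventually_congr hev, eventually_const]

end Ultrapower

/-! ### Stability bounds the local ranks. -/

section Stability

variable {L : FirstOrder.Language.{u, v}} {n : ℕ}

theorem IsStable.exists_not_halfGraph {T : L.Theory} (hT : IsStable.{u, v, w} T)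
    (M : Type (max u v w)) [L.Structure M] [M ⊨ T] [Nonempty M] {J : Type*} {m : J → ℕ}
    (Φ : ∀ j, L.Formula (Fin (m j) ⊕ Fin n)) (j : J) :
    ∃ N, ¬ HalfGraph (instances Φ M) N {i | i.1 = j} Set.univ := by
  by_contra! h
  have h' : ∀ N : ℕ, ∃ (b : Fin N → Fin (m j) → M) (a : Fin N → Fin n → M),
      ∀ s t, (Φ j).Realize (Sum.elim (b s) (a t)) ↔ ((t : Fin N) : ℕ) ≤ (s : Fin N) := by
    intro N
    obtain ⟨a, b, -, hb, hab⟩ := (h N).exists_seq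
    have : ∀ t, ∃ c, b t = ⟨j, c⟩ := fun t => by
      have h2 : (b t).1 = j := hb t
      revert h2
      generalize b t = i
      rintro h2
      obtain ⟨j', c⟩ := i
      subst h2
      exact ⟨c, rfl⟩
    choose c hc using this
    refine ⟨c, a, fun s t => ?_⟩
    have := hab t s
    rw [hc s] at this
    exact this
  obtain ⟨M', _, f, b, a, hab⟩ := exists_infinite_sequences (Φ j) (fun s t => t ≤ s) h'
  have : M' ⊨ T := (f.theory_model_iff T).1 inferInstance
  -- The half graph realizes `≤`; shifting `a` by one gives `s + 1 ≤ t`, the strict order in the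
  -- definition of stability.
  refine hT n (m j) ((Φ j).relabel Sum.swap) M' ⟨fun i => a (i + 1), b, fun s t => ?_⟩
  have hs : Sum.elim (a (s + 1)) (b t) ∘ Sum.swap = Sum.elim (b t) (a (s + 1)) := by
    ext i
    cases i <;> rfl
  rw [Formula.realize_relabel, hs, hab, Nat.succ_le_iff]

theorem IsStable.exists_not_halfGraph_compl {T : L.Theory} (hT : IsStable.{u, v, w} T)
    (M : Type (max u v w)) [L.Structure M] [M ⊨ T] [Nonempty M] {J : Type*} {m : J → ℕ}
    (Φ : ∀ j, L.Formula (Fin (m j) ⊕ Fin n)) (j : J) :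
    ∃ N, ¬ HalfGraph (fun i => (instances Φ M i)ᶜ) N {i | i.1 = j} Set.univ := by
  obtain ⟨N, hN⟩ := hT.exists_not_halfGraph M (fun j => (Φ j).not) j
  refine ⟨N, fun h => hN ?_⟩
  convert h using 2
  ext i
  exact Formula.realize_not

theorem IsStable.exists_not_level {T : L.Theory} (hT : IsStable.{u, v, w} T)
    (M : Type (max u v w)) [L.Structure M] [M ⊨ T] [Nonempty M] {J : Type*} [Finite J] {m : J → ℕ}
    (Φ : ∀ j, L.Formula (Fin (m j) ⊕ Fin n)) :
    ∃ k, ∀ P : ℕ → Set (Fin n → M) → Prop, (∀ S, P 2 S → S.Nonempty) →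
      ∀ S, ¬ Large (Level (instances Φ M) P k) S := by
  have hj : ∀ j, ∃ h, ¬ Tree (instances Φ M) h {i | i.1 = j} Set.univ := by
    intro j
    obtain ⟨p, hp⟩ := hT.exists_not_halfGraph M Φ j
    obtain ⟨q, hq⟩ := hT.exists_not_halfGraph_compl M Φ j
    obtain ⟨h, hh⟩ := exists_halfGraph_of_tree (instances Φ M) p q
    exact ⟨h, fun hT => (hh _ _ hT).elim hp hq⟩
  have := Fintype.ofFinite J
  obtain ⟨k, hk⟩ := exists_not_tree_biUnion Finset.univ _ hj
  refine ⟨k, fun P hP S hS => hk ?_⟩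
  have h := (Tree.of_level hP (hS 2)).mono (Set.subset_univ _)
  convert h using 1
  ext i
  simp

end Stability

/-! ### Isolating formulas and nonforking over finite sets. -/

section Nonforking

variable {L : FirstOrder.Language.{u, v}} {n : ℕ}

theorem exists_realize_congr (φ : L.Formula ℕ) : ∃ m : ℕ, ∀ (N : Type (max u v w)) [L.Structure N]
    (e e' : ℕ → N), (∀ i < m, e i = e' i) → (φ.Realize e ↔ φ.Realize e') := by
  classical
  obtain ⟨m, hm⟩ := (BoundedFormula.freeVarFinset φ).exists_nat_subset_range
  refine ⟨m, fun N _ e e' h => ?_⟩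
  have he : e ∘ ((↑) : (↑(BoundedFormula.freeVarFinset φ) : Set ℕ) → ℕ) = e' ∘ (↑) :=
    funext fun i => h _ (Finset.mem_range.1 (hm i.2))
  unfold Formula.Realize
  rw [← BoundedFormula.realize_restrictFreeVar' subset_rfl (v := e), he,
    BoundedFormula.realize_restrictFreeVar' subset_rfl]

theorem exists_substitution_pattern (A : Type*) (m : ℕ) : ∃ l : ℕ, ∀ σ : Fin m → A ⊕ Fin n,
    ∃ (τ : Fin m → Fin l ⊕ Fin n) (c : Fin l → A), ∀ i, Sum.map c id (τ i) = σ i := by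
  rcases isEmpty_or_nonempty A with hA | ⟨⟨a₀⟩⟩
  · refine ⟨0, fun σ => ?_⟩
    have : ∀ i, ∃ k, σ i = Sum.inr k := fun i => by
      rcases h : σ i with a | k
      · exact isEmptyElim a
      · exact ⟨k, rfl⟩
    choose k hk using this
    exact ⟨fun i => Sum.inr (k i), Fin.elim0, fun i => (hk i).symm⟩
  -- Every variable gets its own parameter slot; slots of variables sent to some `x_i` are filled
  -- with `a₀`.
  · refine ⟨m, fun σ => ⟨fun i => Sum.map (fun _ => i) id (σ i),
      fun i => Sum.elim id (fun _ => a₀) (σ i), fun i => ?_⟩⟩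
    rcases h : σ i with a | k <;> simp [h]

/-- The substitution instances of finitely many formulas are instances of finitely many formulas
with object variables `x_0, …, x_{n-1}` and separate parameter variables. -/
theorem exists_family {Δ : Set (L.Formula ℕ)} (hΔ : Δ.Finite) (A : Type*) (n : ℕ) :
    ∃ (J : Type (max u v)) (_ : Finite J) (l : ℕ) (Φ : J → L.Formula (Fin l ⊕ Fin n)),
      ∀ φ ∈ Δ, ∀ σ : ℕ → A ⊕ Fin n, ∃ (j : J) (c : Fin l → A),
        ∀ (N : Type (max u v w)) [L.Structure N] (g : A → N) (x : Fin n → N),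
          (φ.relabel σ).Realize (Sum.elim g x) ↔ (Φ j).Realize (Sum.elim (g ∘ c) x) := by
  choose m₀ hm₀ using exists_realize_congr.{u, v, w} (L := L)
  obtain ⟨m, hm⟩ := (hΔ.image m₀).bddAbove
  obtain ⟨l, hl⟩ := exists_substitution_pattern (n := n) A (m + 1)
  have := hΔ.to_subtype
  refine ⟨Δ × (Fin (m + 1) → Fin l ⊕ Fin n), inferInstance, l,
    fun j => j.1.1.relabel fun i => j.2 (Fin.ofNat (m + 1) i), fun φ hφ σ => ?_⟩
  obtain ⟨τ, c, hc⟩ := hl (fun i => σ i)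
  refine ⟨(⟨φ, hφ⟩, τ), c, fun N _ g x => ?_⟩
  rw [Formula.realize_relabel, Formula.realize_relabel]
  refine hm₀ φ N _ _ fun i hi => ?_
  have hi' : i < m + 1 := by
    have := hm (Set.mem_image_of_mem m₀ hφ)
    omega
  have h := hc (Fin.ofNat (m + 1) i)
  have hval : ((Fin.ofNat (m + 1) i : Fin (m + 1)) : ℕ) = i := Nat.mod_eq_of_lt hi'
  rw [hval] at h
  simp only [Function.comp_apply, ← h]
  rcases τ (Fin.ofNat (m + 1) i) with y | y <;> rfl

/-- If a set of formulas implies a finite disjunction, then a finite subset of it does. -/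
theorem exists_finset_of_implies {N : Type w} [L.Structure N] [Nonempty N] {A : Type w}
    (p : Set (L.Formula (A ⊕ Fin n))) (e : A → N) {d : ℕ} {m : Fin d → ℕ}
    (φ : ∀ j, L.Formula (Fin (m j) ⊕ Fin n)) (b : ∀ j, Fin (m j) → N)
    (h : ∀ (N' : Type (max u v w)) [L.Structure N'] (g : N ↪ₑ[L] N') (x : Fin n → N'),
      (∀ ρ ∈ p, ρ.Realize (Sum.elim (g ∘ e) x)) →
        ∃ j, (φ j).Realize (Sum.elim (g ∘ b j) x)) :
    ∃ s : Finset (L.Formula (A ⊕ Fin n)), ↑s ⊆ p ∧ ∀ x : Fin n → N,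
      (∀ ρ ∈ s, ρ.Realize (Sum.elim e x)) → ∃ j, (φ j).Realize (Sum.elim (b j) x) := by
  classical
  by_contra! hc
  have hc' : ∀ s : Finset p, ∃ x : Fin n → N, (∀ ρ ∈ s, ρ.1.Realize (Sum.elim e x)) ∧
      ∀ j, ¬ (φ j).Realize (Sum.elim (b j) x) := by
    intro s
    obtain ⟨x, hx, hx'⟩ := hc (s.map (Function.Embedding.subtype _)) (by simp)
    exact ⟨x, fun ρ hρ => hx _ (Finset.mem_map_of_mem _ hρ), hx'⟩
  choose x hx hx' using hc'
  -- An ultrafilter containing all cones of finite subsets, so that the class of the `x s` realizes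
  -- all of `p`.
  let U : Ultrafilter (Finset p) := Ultrafilter.of Filter.atTop
  obtain ⟨j, hj⟩ := h ((U : Filter (Finset p)).Product (fun _ => N)) (diagonal U N)
    (fun i => ((fun s => x s i : Finset p → N) : (U : Filter (Finset p)).Product (fun _ => N)))
    (fun ρ hρ => by
      refine (realize_ultrapower U ρ (fun i _ => e i) (fun i s => x s i)).2 ?_
      refine Ultrafilter.of_le _ ?_
      filter_upwards [Filter.eventually_ge_atTop ({⟨ρ, hρ⟩} : Finset p)] with s hs
      exact hx s ⟨ρ, hρ⟩ (hs (Finset.mem_singleton_self _)))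
  have hj' := (realize_ultrapower U (φ j) (fun i _ => b j i) (fun i s => x s i)).1 hj
  obtain ⟨s, hs⟩ := hj'.exists
  exact hx' s j hs

/-- The local rank predicates of a structure with respect to the family `Φ`. -/
def LocalRank {J : Type*} {m : J → ℕ} (Φ : ∀ j, L.Formula (Fin (m j) ⊕ Fin n)) (M : Type*)
    [L.Structure M] : ℕ → ℕ → Set (Fin n → M) → Prop :=
  Level (instances Φ M) fun _ S => S.Nonempty

theorem LocalRank.graded {J : Type*} {m : J → ℕ} (Φ : ∀ j, L.Formula (Fin (m j) ⊕ Fin n))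
    (M : Type*) [L.Structure M] (r : ℕ) : Graded (LocalRank Φ M r) :=
  graded_nonempty.level r

/-- Largeness is an infinite conjunction of first-order conditions on the parameters, each preserved
by `f`. -/
theorem UniformlyDefinable.large_iff {β : Type}
    {P : ∀ (M : Type (max u v w)) [L.Structure M], (β → M) → ℕ → Set (Fin n → M) → Prop}
    (hP : ∀ N, UniformlyDefinable.{u, v, w, a} (fun M (_ : L.Structure M) e => P M e N))
    {M N : Type (max u v w)} [L.Structure M] [L.Structure N] (f : M ↪ₑ[L] N) {α : Type a}
    (g : β → α) (χ : L.Formula (α ⊕ Fin n)) (e : α → M) :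
    Large (P N (f ∘ e ∘ g)) (solutions χ (f ∘ e)) ↔ Large (P M (e ∘ g)) (solutions χ e) := by
  refine forall_congr' fun k => ?_
  obtain ⟨ψ, hψ⟩ := hP k α g χ
  exact (hψ N (f ∘ e)).trans ((f.map_formula ψ e).trans (hψ M e).symm)

theorem LocalRank.large_iff {J : Type*} [Finite J] {m : J → ℕ}
    (Φ : ∀ j, L.Formula (Fin (m j) ⊕ Fin n)) {M N : Type (max u v w)} [L.Structure M]
    [L.Structure N] (f : M ↪ₑ[L] N) {α : Type a} (χ : L.Formula (α ⊕ Fin n)) (e : α → M) (r : ℕ) :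
    Large (LocalRank Φ N r) (solutions χ (f ∘ e)) ↔ Large (LocalRank Φ M r) (solutions χ e) :=
  UniformlyDefinable.large_iff.{u, v, w, a} (β := Empty)
    (P := fun M (_ : L.Structure M) _ => LocalRank Φ M r)
    (fun k => UniformlyDefinable.level (fun _ => uniformlyDefinable_nonempty) Φ r k) f
    Empty.elim χ e

/-- A local type has a formula over finitely many parameters relative to which each formula of the
type is decided up to smaller local rank. -/
theorem exists_isolating {T : L.Theory} (hT : IsStable.{u, v, w} T) (M : Type (max u v w))
    [L.Structure M] [M ⊨ T] [Nonempty M] {A : Set M} {J : Type*} [Finite J] {l : ℕ}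
    (Φ : J → L.Formula (Fin l ⊕ Fin n)) {N : Type (max u v w)} [L.Structure N] (f : M ↪ₑ[L] N)
    (x : Fin n → N) :
    ∃ (r k : ℕ) (θ : L.Formula (Fin k ⊕ Fin n)) (e : Fin k → A),
      Large (LocalRank Φ M r) (solutions θ (fun i => (e i : M))) ∧
      ∀ (j : J) (c : Fin l → A),
        ((Φ j).Realize (Sum.elim (fun i => f (c i)) x) →
          ¬ Large (LocalRank Φ M r) (solutions θ (fun i => (e i : M)) \
            solutions (Φ j) (fun i => (c i : M)))) ∧
        (¬ (Φ j).Realize (Sum.elim (fun i => f (c i)) x) →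
          ¬ Large (LocalRank Φ M r) (solutions θ (fun i => (e i : M)) ∩
            solutions (Φ j) (fun i => (c i : M)))) := by
  -- These are the sets defined by the complete type of `x` over `A`. They are closed under
  -- intersection, and nonempty in `M` by elementarity.
  let 𝒮 : Set (Set (Fin n → M)) := {S | ∃ (k : ℕ) (θ : L.Formula (Fin k ⊕ Fin n)) (e : Fin k → A),
    S = solutions θ (fun i => (e i : M)) ∧ θ.Realize (Sum.elim (fun i => f (e i)) x)}
  have hinter : ∀ S ∈ 𝒮, ∀ ψ : L.Formula (Fin l ⊕ Fin n), ∀ c : Fin l → A,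
      ψ.Realize (Sum.elim (fun i => f (c i)) x) →
        S ∩ solutions ψ (fun i => (c i : M)) ∈ 𝒮 := by
    rintro _ ⟨k, θ, e, rfl, hθ⟩ ψ c hψ
    refine ⟨k + l, θ.relabel (Sum.map (Fin.castAdd l) id) ⊓ ψ.relabel (Sum.map (Fin.natAdd k) id),
      Fin.append e c, ?_, ?_⟩
    · rw [solutions_inf, solutions_relabel, solutions_relabel]
      congr 2 <;> ext i <;> simp
    · rw [Formula.realize_inf, Formula.realize_relabel, Formula.realize_relabel, Sum.elim_comp_map,
        Sum.elim_comp_map, Function.comp_id]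
      constructor
      · convert hθ using 2
        ext i
        simp
      · convert hψ using 2
        ext i
        simp
  obtain ⟨K, hK⟩ := hT.exists_not_level M Φ
  obtain ⟨r, _, ⟨k, θ, e, rfl, -⟩, hθ, h⟩ := exists_minimal
    (R := instances (m := fun _ => l) Φ M) (P := fun _ S => S.Nonempty)
    (hK _ fun S h => h) (𝒮 := 𝒮) ⟨_, 0, ⊤, Fin.elim0, rfl, by simp⟩
    (fun S hS _ => by
      obtain ⟨k, θ, e, rfl, hθ⟩ := hS
      have h1 : (θ.iExs (Fin n)).Realize (f ∘ fun i => (e i : M)) :=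
        Formula.realize_iExs.2 ⟨x, hθ⟩
      rw [f.map_formula] at h1
      exact Formula.realize_iExs.1 h1)
    (I₀ := {i | ∀ y, i.2 y ∈ A})
    (r := fun i => (Φ i.1).Realize (Sum.elim (fun y => f (i.2 y)) x))
    (fun S hS i hi h => hinter S hS (Φ i.1) (fun y => ⟨i.2 y, hi y⟩) h)
    (fun S hS i hi h => by
      have := hinter S hS (Φ i.1).not (fun y => ⟨i.2 y, hi y⟩) (Formula.realize_not.2 h)
      rwa [solutions_not, ← Set.sdiff_eq] at this)
  exact ⟨r, k, θ, e, hθ, fun j c => h ⟨j, fun y => c y⟩ fun y => (c y).2⟩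

theorem BoolGenerated.not_large {M : Type (max u v w)} [L.Structure M] {A : Set M}
    {N : Type (max u v w)} [L.Structure N] (f : M ↪ₑ[L] N) (x : Fin n → N)
    {P : ℕ → Set (Fin n → M) → Prop} (hP : Graded P) (hne : ∀ S, Large P S → S.Nonempty)
    (U : Set (Fin n → M)) {Δ : Set (L.Formula ℕ)} (σ : ℕ → A ⊕ Fin n)
    (h : ∀ φ ∈ Δ,
      ((φ.relabel σ).Realize (Sum.elim (fun a : A => f a) x) →
        ¬ Large P (U \ solutions (φ.relabel σ) (fun a : A => (a : M)))) ∧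
      (¬ (φ.relabel σ).Realize (Sum.elim (fun a : A => f a) x) →
        ¬ Large P (U ∩ solutions (φ.relabel σ) (fun a : A => (a : M)))))
    {φ : L.Formula ℕ} (hφ : BoolGenerated Δ φ) :
    ((φ.relabel σ).Realize (Sum.elim (fun a : A => f a) x) →
        ¬ Large P (U \ solutions (φ.relabel σ) (fun a : A => (a : M)))) ∧
      (¬ (φ.relabel σ).Realize (Sum.elim (fun a : A => f a) x) →
        ¬ Large P (U ∩ solutions (φ.relabel σ) (fun a : A => (a : M)))) := by
  induction hφ with
  | of_mem hφ => exact h _ hφ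
  | bot =>
    simp only [Formula.realize_relabel, Formula.realize_bot, false_imp_iff, true_and]
    intro _ h
    obtain ⟨y, -, hy⟩ := hne _ h
    simp [solutions] at hy
  | @not φ _ ih =>
    have : solutions (φ.not.relabel σ) (fun a : A => (a : M)) =
        (solutions (φ.relabel σ) (fun a : A => (a : M)))ᶜ := by
      ext y
      simp [solutions]
    rw [this, Set.sdiff_compl, ← Set.sdiff_eq]
    simp only [Formula.realize_relabel, Formula.realize_not, not_not] at ih ⊢
    exact ⟨ih.2, ih.1⟩
  | @inf φ ψ _ _ ih ih' =>
    have : solutions ((φ ⊓ ψ).relabel σ) (fun a : A => (a : M)) =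
        solutions (φ.relabel σ) (fun a : A => (a : M)) ∩
          solutions (ψ.relabel σ) (fun a : A => (a : M)) := by
      ext y
      simp [solutions]
    rw [this]
    simp only [Formula.realize_relabel, Formula.realize_inf] at ih ih' ⊢
    refine ⟨fun ⟨h1, h2⟩ hl => ?_, fun hn hl => ?_⟩
    · rw [Set.sdiff_inter] at hl
      exact (Large.union hP hl).elim (ih.1 h1) (ih'.1 h2)
    · rcases not_and_or.1 hn with hn | hn
      · exact ih.2 hn (hl.mono hP (Set.inter_subset_inter_right _ Set.inter_subset_left))
      · exact ih'.2 hn (hl.mono hP (Set.inter_subset_inter_right _ Set.inter_subset_right))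
  | @sup φ ψ _ _ ih ih' =>
    have : solutions ((φ ⊔ ψ).relabel σ) (fun a : A => (a : M)) =
        solutions (φ.relabel σ) (fun a : A => (a : M)) ∪
          solutions (ψ.relabel σ) (fun a : A => (a : M)) := by
      ext y
      simp [solutions]
    rw [this]
    simp only [Formula.realize_relabel, Formula.realize_sup] at ih ih' ⊢
    refine ⟨fun hn hl => ?_, fun hn hl => ?_⟩
    · rcases hn with hn | hn
      · exact ih.1 hn (hl.mono hP (Set.sdiff_subset_sdiff_right Set.subset_union_left))
      · exact ih'.1 hn (hl.mono hP (Set.sdiff_subset_sdiff_right Set.subset_union_right))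
    · rw [Set.inter_union_distrib_left] at hl
      exact (Large.union hP hl).elim (ih.2 fun h => hn (Or.inl h)) (ih'.2 fun h => hn (Or.inr h))

/-- If `θ` has large local rank, and each formula of `p` holds on `θ` up to smaller local rank, then
`p` does not fork over the parameters of `θ`. -/
theorem not_forks_of_isolating {T : L.Theory} (hT : IsStable.{u, v, w} T) (M : Type (max u v w))
    [L.Structure M] [M ⊨ T] [Nonempty M] {A : Set M} {J : Type*} [Finite J] {m : J → ℕ}
    (Φ : ∀ j, L.Formula (Fin (m j) ⊕ Fin n)) {r k : ℕ} (θ : L.Formula (Fin k ⊕ Fin n))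
    (e : Fin k → M) (hθ : Large (LocalRank Φ M r) (solutions θ e))
    (p : Set (L.Formula (A ⊕ Fin n)))
    (hp : ∀ ρ ∈ p, ¬ Large (LocalRank Φ M r)
      (solutions θ e \ solutions ρ (fun a : A => (a : M))))
    (he : ∀ i, e i ∈ A) :
    ¬ Forks.{u, v, w} p (Set.range e) := by
  classical
  rintro ⟨N, _, f, d, l, φ, b, hdiv, himp⟩
  have hNT : N ⊨ T := (f.theory_model_iff T).1 inferInstance
  have hN : Nonempty N := Nonempty.map f inferInstance
  obtain ⟨s, hsp, hs⟩ := exists_finset_of_implies.{u, v, max u v w} p (fun a : A => f a) φ b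
    fun N' _ g x hx => himp N' g x hx
  -- The second rank: splittings by instances of the dividing formulas `φ`, counting a piece at the
  -- bottom level when its part in `θ` has `Φ`-rank at least `r`.
  let Q : ∀ (N : Type (max u v w)) [L.Structure N], (Fin k → N) → ℕ → ℕ → Set (Fin n → N) → Prop :=
    fun N _ e => Level (instances φ N) fun i S => LocalRank Φ N r i (solutions θ e ∩ S)
  have hQ₀ : ∀ (N : Type (max u v w)) [L.Structure N] (e : Fin k → N),
      Graded fun i S => LocalRank Φ N r i (solutions θ e ∩ S) :=
    fun N _ e => (LocalRank.graded Φ N r).inter _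
  have hQ : ∀ (N : Type (max u v w)) [L.Structure N] (e : Fin k → N) (t : ℕ), Graded (Q N e t) :=
    fun N _ e t => (hQ₀ N e).level t
  have hne₀ : ∀ (N : Type (max u v w)) [L.Structure N] (e : Fin k → N) (S : Set (Fin n → N)) (i : ℕ),
      0 < i → LocalRank Φ N r i (solutions θ e ∩ S) → S.Nonempty := fun N _ e S i hi h =>
    (graded_nonempty.level_le hi h).mono Set.inter_subset_right
  have hne : ∀ (N : Type (max u v w)) [L.Structure N] (e : Fin k → N) (t : ℕ) (S : Set (Fin n → N)),
      Large (Q N e t) S → S.Nonempty := fun N _ e t S h =>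
    hne₀ N e S 1 one_pos ((hQ₀ N e).large_of_level h 1)
  have hdef : ∀ t i, UniformlyDefinable.{u, v, w, 0}
      (fun N (_ : L.Structure N) (e : Fin k → N) => Q N e t i) := fun t i =>
    UniformlyDefinable.level (fun i => UniformlyDefinable.inter
      (UniformlyDefinable.level (fun _ => uniformlyDefinable_nonempty) Φ r i) θ) φ t i
  have huniv : Large (Q N (f ∘ e) 0) Set.univ := by
    have := (LocalRank.large_iff Φ f θ e r).2 hθ
    intro i
    change LocalRank Φ N r i (solutions θ (f ∘ e) ∩ Set.univ)
    rw [Set.inter_univ]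
    exact this i
  obtain ⟨K, hK⟩ := hT.exists_not_level N φ
  have hex : ∃ t, ¬ Large (Q N (f ∘ e) t) Set.univ :=
    ⟨K, hK _ (fun S h => hne₀ N _ S 2 two_pos h) _⟩
  -- `t` is the exact second rank of the whole space, finite by stability.
  obtain ⟨t, ht, ht'⟩ : ∃ t, Large (Q N (f ∘ e) t) Set.univ ∧
      ¬ Large (Q N (f ∘ e) (t + 1)) Set.univ := by
    obtain ⟨t, ht⟩ := Nat.exists_eq_succ_of_ne_zero
      (n := Nat.find hex) fun h0 => Nat.find_spec hex (by rwa [h0])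
    refine ⟨t, not_not.1 (Nat.find_min hex (m := t) (by omega)), ?_⟩
    have := Nat.find_spec hex
    rwa [ht] at this
  -- The disjuncts and the complements of the formulas in `s` cover the space. A complement is not
  -- large even at the bottom level, by `hp`, so some disjunct is large at level `t`.
  have hcover : Large (Q N (f ∘ e) t) ((⋃ ρ ∈ s, (solutions ρ (fun a : A => f a))ᶜ) ∪
      ⋃ j ∈ (Finset.univ : Finset (Fin d)), solutions (φ j) (b j)) := by
    refine ht.mono (hQ _ _ _) fun x _ => ?_
    by_cases hx : ∀ ρ ∈ s, ρ.Realize (Sum.elim (fun a : A => f a) x)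
    · obtain ⟨j, hj⟩ := hs x hx
      exact Or.inr (Set.mem_iUnion₂.2 ⟨j, Finset.mem_univ _, hj⟩)
    · push Not at hx
      obtain ⟨ρ, hρ, hx⟩ := hx
      exact Or.inl (Set.mem_iUnion₂.2 ⟨ρ, hρ, hx⟩)
  obtain ⟨j, hj⟩ : ∃ j, Large (Q N (f ∘ e) t) (solutions (φ j) (b j)) := by
    rcases Large.union (hQ _ _ _) hcover with h | h
    · obtain ⟨ρ, hρ, h⟩ := Large.exists_of_biUnion (hQ _ _ _) (hne _ _ _) _ _ h
      refine absurd ?_ (hp ρ (hsp hρ))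
      have h1 := (hQ₀ N (f ∘ e)).large_of_level h
      have h2 := LocalRank.large_iff Φ f
        (θ.relabel (Sum.map (fun i => (⟨e i, he i⟩ : A)) id) ⊓ ρ.not) (fun a : A => (a : M)) r
      simp only [solutions_inf, solutions_not, solutions_relabel, ← Set.sdiff_eq] at h2
      exact h2.1 h1
    · obtain ⟨j, -, h⟩ := Large.exists_of_biUnion (hQ _ _ _) (hne _ _ _) _ _ h
      exact ⟨j, h⟩
  obtain ⟨q, N₂, _, f₂, c, hc, hinc⟩ := hdiv j
  -- Level `t` is definable over `e` and the parameters of `φ j`, so it passes from `b j` to every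
  -- `c i` of the same type over `e`.
  have hlarge : ∀ i, Large (Q N₂ (f₂ ∘ f ∘ e) t) (solutions (φ j) (c i)) := by
    intro i y
    obtain ⟨ψ, hψ⟩ := hdef t y (Fin k ⊕ Fin (l j)) Sum.inl ((φ j).relabel (Sum.map Sum.inr id))
    have h1 := (hψ N (Sum.elim (f ∘ e) (b j))).1 (by
      rw [solutions_relabel]
      exact hj y)
    have h2 := hψ N₂ (Sum.elim (f₂ ∘ f ∘ e) (c i))
    rw [solutions_relabel] at h2
    refine h2.2 ?_
    have h3 := hc i (ψ.relabel (Sum.map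
      (fun y => (⟨f (e y), Set.mem_image_of_mem f (Set.mem_range_self y)⟩ : f '' Set.range e)) id))
    rw [Formula.realize_relabel, Formula.realize_relabel, Sum.elim_comp_map,
      Sum.elim_comp_map] at h3
    exact h3.2 h1
  have hcomb : Large (Q N₂ (f₂ ∘ f ∘ e) (t + 1)) Set.univ := fun y =>
    large_of_inconsistent (R := instances φ N₂) (hQ N₂ _ t) (hne N₂ _ t) (fun i => ⟨j, c i⟩) q
      Set.univ Set.infinite_univ Set.univ
      (fun i _ => by
        rw [Set.univ_inter]
        exact hlarge i)
      (fun s _ hs ⟨x, _, hx⟩ => hinc s hs ⟨x, hx⟩) y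
  have htop : ∀ (N : Type (max u v w)) [L.Structure N] (e : Fin k → N),
      solutions (⊤ : L.Formula (Fin k ⊕ Fin n)) e = Set.univ := fun N _ e => by
    ext x
    simp [solutions]
  -- Level `t + 1` of the whole space was reached in `N₂`; elementarity brings it back to `N`,
  -- against the choice of `t`.
  have h := UniformlyDefinable.large_iff (hdef (t + 1)) f₂ id ⊤ (f ∘ e)
  rw [htop, htop] at h
  exact ht' (h.1 hcomb)

theorem exists_finite_not_forks {T : L.Theory} (hT : IsStable.{u, v, w} T) (M : Type (max u v w))
    [L.Structure M] [M ⊨ T] [Nonempty M] (A : Set M) (Δ : Set (L.Formula ℕ)) (n : ℕ)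
    (hΔ : Δ.Finite) (p : Set (L.Formula (A ⊕ Fin n))) (hp : p ∈ deltaTypes.{u, v, w} Δ A n) :
    ∃ A₀ : Set M, A₀ ⊆ A ∧ A₀.Finite ∧ ¬ Forks.{u, v, w} p A₀ := by
  obtain ⟨⟨hpΔ, N, _, f, x, hx⟩, -⟩ := hp
  obtain ⟨J, _, l, Φ, hΦ⟩ := exists_family.{u, v, w} hΔ A n
  obtain ⟨r, k, θ, e, hθ, h⟩ := exists_isolating hT M (A := A) Φ f x
  refine ⟨Set.range fun i => (e i : M), ?_, Set.finite_range _,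
    not_forks_of_isolating hT M Φ θ (fun i => (e i : M)) hθ p ?_ fun i => (e i).2⟩
  · rintro _ ⟨i, rfl⟩
    exact (e i).2
  intro ρ hρ
  obtain ⟨φ, hφ, σ, rfl⟩ := hpΔ hρ
  refine (BoolGenerated.not_large f x (LocalRank.graded Φ M r) (fun S hS =>
    graded_nonempty.large_of_level hS 0) _ σ ?_ hφ).1 (hx _ hρ)
  intro φ hφ
  obtain ⟨j, c, hjc⟩ := hΦ φ hφ σ
  have hsol : solutions (φ.relabel σ) (fun a : A => (a : M)) =
      solutions (Φ j) (fun i => (c i : M)) := by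
    ext y
    exact hjc M _ y
  rw [hsol, hjc N]
  exact h j c

end Nonforking

/-! ### No finite cardinal bounds local character. -/

section LowerBound

variable {L : FirstOrder.Language.{u, v}}

theorem SameType.mono {M N : Type*} [L.Structure M] [L.Structure N] {f : M ↪ₑ[L] N} {A B : Set M}
    (h : A ⊆ B) {m : ℕ} {b : Fin m → M} {c : Fin m → N} (hB : SameType f B b c) :
    SameType f A b c := by
  intro ψ
  have := hB (ψ.relabel (Sum.map (Set.inclusion h) id))
  rwa [Formula.realize_relabel, Formula.realize_relabel, Sum.elim_comp_map, Sum.elim_comp_map,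
    Function.comp_id, Function.comp_id] at this

theorem mk_set_formula_le {α : Type (max u v w)} :
    #(Set (L.Formula α)) ≤ 2 ^ max ℵ₀ (#α + Cardinal.lift.{w} L.card) := by
  rw [mk_set]
  refine Cardinal.power_le_power_left two_ne_zero ?_
  have h : #(L.Formula α) ≤ #(Σ n, L.BoundedFormula α n) :=
    mk_le_of_injective (f := fun φ : L.Formula α => (⟨0, φ⟩ : Σ n, L.BoundedFormula α n))
      fun _ _ h => by simpa using h
  refine h.trans (BoundedFormula.card_le.trans ?_)
  rw [Cardinal.lift_id'.{max u v, max u v w}, Cardinal.lift_umax.{max u v, w}]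

/-- Every sufficiently large set contains `k` distinct elements, each of which has infinitely many
conjugates over the other ones. -/
theorem exists_independent (L : FirstOrder.Language.{u, v}) (k : ℕ) :
    ∃ μ : Cardinal.{max u v w}, ∀ (M : Type (max u v w)) [L.Structure M] (C E : Set M), μ ≤ #C →
      E.Finite → ∃ D : Finset M, ↑D ⊆ C ∧ D.card = k ∧ ∀ a ∈ D,
        {c : M | SameType (ElementaryEmbedding.refl L M) (E ∪ (↑D \ {a}))
          (fun _ : Fin 1 => a) (fun _ => c)}.Infinite := by
  classical
  induction k with
  | zero => exact ⟨0, fun M _ C E _ _ => ⟨∅, by simp, rfl, by simp⟩⟩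
  | succ k ih =>
    obtain ⟨μ, hμ⟩ := ih
    -- `2 ^ ν` bounds the number of types over a set of size `μ` together with `E`, so more than `2
    -- ^ ν` elements include infinitely many of one type.
    let ν : Cardinal.{max u v w} := max ℵ₀ ((μ + ℵ₀ + 1) + Cardinal.lift.{w} L.card)
    have hμν : μ ≤ ν := le_max_of_le_right
      ((self_le_add_right μ ℵ₀).trans ((self_le_add_right _ 1).trans (self_le_add_right _ _)))
    refine ⟨Order.succ (2 ^ ν), fun M _ C E hC hE => ?_⟩
    have hνC : 2 ^ ν < #C := Order.succ_le_iff.1 hC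
    obtain ⟨C', hC'C, hC'⟩ := le_mk_iff_exists_subset.1
      (hμν.trans ((cantor ν).le.trans hνC.le))
    let F : C → Set (L.Formula ((C' ∪ E : Set M) ⊕ Fin 1)) := fun c =>
      {ψ | ψ.Realize (Sum.elim (fun b => (b : M)) (fun _ => (c : M)))}
    have hF : #(Set (L.Formula ((C' ∪ E : Set M) ⊕ Fin 1))) < #C := by
      refine lt_of_le_of_lt (mk_set_formula_le.{u, v, w}.trans ?_) hνC
      refine Cardinal.power_le_power_left two_ne_zero (max_le_max le_rfl (add_le_add_left ?_ _))
      have h1 : #(C' ∪ E : Set M) ≤ μ + ℵ₀ :=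
        (mk_union_le _ _).trans (add_le_add hC'.le hE.lt_aleph0.le)
      simpa using add_le_add_left h1 1
    have : Infinite C := Cardinal.infinite_iff.2
      ((le_max_left _ _).trans ((cantor ν).le.trans hνC.le))
    obtain ⟨q, hq⟩ := exists_infinite_fiber F hF
    obtain ⟨a, ha⟩ := hq.nonempty
    have hinf : {c : M | SameType (ElementaryEmbedding.refl L M) (C' ∪ E)
        (fun _ : Fin 1 => (a : M)) (fun _ => c)}.Infinite := by
      refine ((Set.infinite_coe_iff.1 hq).image Subtype.val_injective.injOn).mono ?_
      rintro _ ⟨c, hc, rfl⟩ ψ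
      have : F c = F a := (Set.mem_singleton_iff.1 hc).trans (Set.mem_singleton_iff.1 ha).symm
      exact (Set.ext_iff.1 this ψ)
    -- The remaining elements are taken from `C'`, with `a` added to the base: they keep infinitely
    -- many conjugates over `a`, and `a` over all of `C'`.
    obtain ⟨D, hD, hDk, hDinf⟩ := hμ M C' (insert (a : M) E) hC'.ge (hE.insert _)
    have haC' : (a : M) ∉ C' := by
      intro haC'
      refine hinf ((Set.finite_singleton (a : M)).subset fun c hc => ?_)
      have := (hc (Term.equal (Term.var (Sum.inl ⟨a, Or.inl haC'⟩)) (Term.var (Sum.inr 0)))).2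
        (by simp [Formula.realize_equal])
      simpa [Formula.realize_equal, eq_comm] using this
    have haD : (a : M) ∉ D := fun h => haC' (hD h)
    refine ⟨insert (a : M) D, ?_, ?_, ?_⟩
    · rw [Finset.coe_insert]
      exact Set.insert_subset a.2 (hD.trans hC'C)
    · rw [Finset.card_insert_of_notMem haD, hDk]
    · intro b hb
      rcases Finset.mem_insert.1 hb with rfl | hb
      · refine hinf.mono fun c hc => SameType.mono ?_ hc
        rintro y (hy | ⟨hy, hya⟩)
        · exact Or.inr hy
        · rcases Finset.mem_insert.1 (Finset.mem_coe.1 hy) with h | h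
          · exact absurd h hya
          · exact Or.inl (hD h)
      · refine (hDinf b hb).mono fun c hc => SameType.mono ?_ hc
        rintro y (hy | ⟨hy, hyb⟩)
        · exact Or.inl (Or.inr hy)
        · rcases Finset.mem_insert.1 (Finset.mem_coe.1 hy) with h | h
          · exact Or.inl (Or.inl h)
          · exact Or.inr ⟨h, hyb⟩

/-- The formulas of `L_{x,Δ}(A)` satisfied by a tuple in `M` form a local type. -/
theorem setOf_realize_mem_deltaTypes {M : Type (max u v w)} [L.Structure M]
    (Δ : Set (L.Formula ℕ)) (A : Set M) {n : ℕ} (x : Fin n → M) :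
    {ψ ∈ localFormulas Δ A n | ψ.Realize (Sum.elim (fun a : A => (a : M)) x)} ∈
      deltaTypes.{u, v, w} Δ A n := by
  refine ⟨⟨Set.sep_subset _ _, M, _, ElementaryEmbedding.refl L M, x, fun φ hφ => hφ.2⟩, ?_⟩
  rintro q ⟨hq, N, _, f, y, hy⟩ hle ψ hψ
  refine ⟨hq hψ, ?_⟩
  by_contra hn
  -- Maximality holds because local formulas are closed under negation.
  obtain ⟨φ, hφ, σ, rfl⟩ := hq hψ
  have h := hy _ (hle ⟨⟨φ.not, hφ.not, σ, rfl⟩, by simpa [Formula.realize_relabel] using hn⟩)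
  have h' := hy _ hψ
  simp only [Formula.realize_relabel, Formula.realize_not] at h h'
  exact h h'

theorem not_localCharacter_natCast {T : L.Theory} (M : Type (max u v w)) [L.Structure M] [M ⊨ T]
    [Infinite M] (k : ℕ) : ¬ LocalCharacter.{u, v, w} T (k : Cardinal.{max u v w}) := by
  intro hT
  obtain ⟨μ, hμ⟩ := exists_independent.{u, v, w} L k
  obtain ⟨⟨N, _⟩, ⟨f⟩, hN⟩ := exists_elementaryEmbedding_card_eq_of_ge L M
    (max μ (max (Cardinal.lift.{w} L.card) #M))
    (by simp) (by simp)
  change #N = _ at hN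
  have : N ⊨ T := (f.theory_model_iff T).1 inferInstance
  have : Nonempty N := Nonempty.map f inferInstance
  obtain ⟨D, -, hDk, hD⟩ := hμ N Set.univ ∅ (by rw [mk_univ, hN]; exact le_max_left _ _)
    Set.finite_empty
  let e : Fin k ≃ D := (D.equivFinOfCardEq hDk).symm
  let E : L.Formula ℕ := Term.equal (Term.var 0) (Term.var 1)
  obtain ⟨A₀, hA₀, hcard, hforks⟩ := hT N (↑D) {E} k (Set.finite_singleton E) _
    (setOf_realize_mem_deltaTypes {E} (↑D : Set N) (fun i => (e i : N)))
  obtain ⟨a, haD, haA₀⟩ : ∃ a ∈ D, a ∉ A₀ := by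
    by_contra! h
    have h1 : #(↑D : Set N) ≤ #A₀ := mk_le_mk_of_subset h
    refine absurd hcard (not_lt.2 (le_trans ?_ h1))
    simp [hDk]
  -- The single disjunct says that the coordinate of `x` enumerating `a` equals `a`. It divides over
  -- `A₀`, since distinct conjugates of `a` give pairwise contradictory equations, and it belongs to
  -- the local type as an instance of `E`.
  refine hforks ⟨N, _, ElementaryEmbedding.refl L N, 1, fun _ => 1, fun _ => Term.equal
    (Term.var (Sum.inl 0)) (Term.var (Sum.inr (e.symm ⟨a, haD⟩))), fun _ _ => a, fun _ => ?_, ?_⟩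
  · let c := (hD a haD).natEmbedding
    refine ⟨2, N, _, ElementaryEmbedding.refl L N, fun i _ => c i, fun i => ?_, ?_⟩
    · refine SameType.mono ?_ (c i).2
      rintro _ ⟨y, hy, rfl⟩
      exact Or.inr ⟨hA₀ hy, fun h => haA₀ (by
        rw [← Set.mem_singleton_iff.1 h]
        exact hy)⟩
    · rintro s hs ⟨x, hx⟩
      obtain ⟨i, j, hij, rfl⟩ := Finset.card_eq_two.1 hs
      have hi := hx i (by simp)
      have hj := hx j (by simp)
      simp only [Formula.realize_equal, Term.realize_var, Sum.elim_inl, Sum.elim_inr] at hi hj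
      exact hij (c.injective (Subtype.ext (hi.trans hj.symm)))
  · intro N' _ g x hx
    refine ⟨0, ?_⟩
    let σ : ℕ → (↑D : Set N) ⊕ Fin k := fun i =>
      if i = 0 then Sum.inl ⟨a, haD⟩ else Sum.inr (e.symm ⟨a, haD⟩)
    have h := hx (E.relabel σ) ⟨⟨E, .of_mem rfl, σ, rfl⟩, by
      simp [E, σ, Formula.realize_relabel, Formula.realize_equal]⟩
    simpa [E, σ, Formula.realize_relabel, Formula.realize_equal] using h

theorem kappaLoc_eq_aleph0 {T : L.Theory} (h : LocalCharacter.{u, v, w} T ℵ₀)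
    (M : Type (max u v w)) [L.Structure M] [M ⊨ T] [Infinite M] :
    kappaLoc.{u, v, w} T = ((ℵ₀ : Cardinal.{max u v w}) : WithTop Cardinal.{max u v w}) := by
  refine IsLeast.csInf_eq ⟨⟨ℵ₀, h, rfl⟩, ?_⟩
  rintro _ ⟨κ, hκ, rfl⟩
  refine WithTop.coe_le_coe.2 (not_lt.1 fun hlt => ?_)
  obtain ⟨k, rfl⟩ := lt_aleph0.1 hlt
  exact not_localCharacter_natCast M k hκ

end LowerBound

end LocalForking

theorem mainTheorem12 {L : FirstOrder.Language.{u, v}} (T : L.Theory) (hT : T.IsComplete)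
    (hstable : LocalForking.IsStable.{u, v, w} T) :
    (∀ (M : Type (max u v w)) [L.Structure M] [M ⊨ T] [Nonempty M] (A : Set M)
      (Δ : Set (L.Formula ℕ)) (n : ℕ), Δ.Finite →
      ∀ p ∈ LocalForking.deltaTypes.{u, v, w} Δ A n,
        ∃ A₀ : Set M, A₀ ⊆ A ∧ A₀.Finite ∧ ¬ LocalForking.Forks.{u, v, w} p A₀) ∧
    ((∃ M : FirstOrder.Language.Theory.ModelType.{u, v, max u v w} T, Infinite M) →
      LocalForking.kappaLoc.{u, v, w} T =
        ((ℵ₀ : Cardinal.{max u v w}) : WithTop Cardinal.{max u v w})) := by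
  have h := LocalForking.exists_finite_not_forks hstable
  refine ⟨h, ?_⟩
  rintro ⟨M, hM⟩
  refine LocalForking.kappaLoc_eq_aleph0 (fun M _ _ _ A Δ n hΔ p hp => ?_) M
  obtain ⟨A₀, h1, h2, h3⟩ := h M A Δ n hΔ p hp
  exact ⟨A₀, h1, h2.lt_aleph0, h3⟩
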